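/- Let $S_n$ act on $(\mathbb C^2)^{\otimes n}$ by permuting the qubits, $\pi(\sigma)(e_{i_1}\otimes\cdots\otimes e_{i_n}) = e_{i_{\sigma^{-1}(1)}}\otimes\cdots\otimes e_{i_{\sigma^{-1}(n)}}$. Let $k\ge 1$ and let $H=\sum_{\sigma\in S_n} c_\sigma\,\pi(\sigma)$ be a Hermitian operator whose coefficients $c_\sigma\in\mathbb C$ vanish unless $\sigma$ moves at most $k$ points. Put $C=\max_\sigma|c_\sigma|$, $L(k)=2^{k-1}C$, and, for $t>0$ and $\epsilon>0$, $x=t\,L(k)\,n^k$; assume $x\ge 1$ and $x/\epsilon>e$ (so that $\log\log(x/\epsilon)$ is defined and positive). Consider quantum circuits on $n$ system qubits and some ancilla qubits made of two kinds of gates: unitaries acting on the ancilla qubits only, and applications of a $k$-local Pauli operator to the system, where the ancilla register may select which one, i.e. gates $\sum_j P_j\otimes|j\rangle\langle j|$ with every $P_j$ a tensor product of Pauli matrices $I,X,Y,Z$ that is nontrivial on at most $k$ qubits (each such gate counts as one Pauli operator). Then there is a circuit $Q$ of this form with $$|\langle u|e^{-itH}|v\rangle-\langle u,0|\,Q\,|v,0\rangle|\le\epsilon$$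 for all unit vectors $u,v\in(\mathbb C^2)^{\otimes n}$ (in particular for all elements of the Young basis), where $|0\rangle$ is the all-zero state of the ancilla qubits, and $Q$ uses $$O\left(t\,L(k)\,n^k\,\frac{\log (t L(k) n^k/\epsilon)}{\log\log (t L(k) n^k/\epsilon)}\right)$$ $k$-local Pauli operators and $O\left(k\log (n+1)\,\frac{\log (t L(k) n^k/\epsilon)}{\log\log (t L(k) n^k/\epsilon)}\right)$ ancilla qubits. The constants in both bounds are absolute: they do not depend on $n,k,c,t,\epsilon$. -/

import Mathlib

/-! Qubit registers, the permutation representation on them, Pauli strings, and quantum circuits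
whose access to the system register is through Pauli operators. -/

/-- Computational basis states of a register of `n` qubits. -/
abbrev Bits (n : ℕ) : Type := Fin n → Fin 2

/-- Operators on a register of `n` qubits, in the computational basis. -/
abbrev QOp (n : ℕ) : Type := Matrix (Bits n) (Bits n) ℂ

/-- State space `(ℂ²)^{⊗ n}` of `n` qubits with its Hilbert space norm. -/
abbrev QState (n : ℕ) : Type := EuclideanSpace ℂ (Bits n)

/-- The matrix element `⟨u| A |v⟩`. -/
noncomputable def matElem {n : ℕ} (A : QOp n) (u v : QState n) : ℂ :=
  dotProduct (star u.ofLp) (A.mulVec v.ofLp)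

/-- The permutation representation: `π(σ) e_y = e_{y ∘ σ⁻¹}`. -/
def permOp {n : ℕ} (σ : Equiv.Perm (Fin n)) : QOp n :=
  Matrix.of fun x y => if x = y ∘ (σ⁻¹ : Equiv.Perm (Fin n)) then 1 else 0

/-- `π̃(c) = ∑ σ, c σ π(σ)` for an element `c` of the group algebra `ℂ[S_n]`. -/
noncomputable def groupAlgOp {n : ℕ} (c : Equiv.Perm (Fin n) → ℂ) : QOp n :=
  ∑ σ, c σ • permOp σ

/-- An element of `ℂ[S_n]` is `k`-local if only permutations moving at most `k` points occur. -/
def IsLocalElement {n : ℕ} (k : ℕ) (c : Equiv.Perm (Fin n) → ℂ) : Prop :=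
  ∀ σ, c σ ≠ 0 → σ.support.card ≤ k

/-- `C = max_σ |c σ|`. -/
noncomputable def maxCoeff {n : ℕ} (c : Equiv.Perm (Fin n) → ℂ) : ℝ :=
  Finset.univ.sup' Finset.univ_nonempty fun σ => ‖c σ‖

/-- The time evolution operator `exp(-i t H)`. -/
noncomputable def evolution {n : ℕ} (H : QOp n) (t : ℝ) : QOp n :=
  NormedSpace.exp ((-(Complex.I * (t : ℂ))) • H)

/-- Labels of the single-qubit Pauli matrices. -/
inductive Pauli : Type where
  | I
  | X
  | Y
  | Z
  deriving DecidableEq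

/-- The single-qubit Pauli matrices. -/
def Pauli.toMatrix : Pauli → Matrix (Fin 2) (Fin 2) ℂ
  | .I => !![1, 0; 0, 1]
  | .X => !![0, 1; 1, 0]
  | .Y => !![0, -Complex.I; Complex.I, 0]
  | .Z => !![1, 0; 0, -1]

/-- An `n`-qubit Pauli operator, given by its tensor factors. -/
abbrev PauliString (n : ℕ) : Type := Fin n → Pauli

/-- The tensor product of the factors of a Pauli string. -/
def PauliString.toOp {n : ℕ} (p : PauliString n) : QOp n :=
  Matrix.of fun x y => ∏ i, (p i).toMatrix (x i) (y i)

/-- A Pauli string is `k`-local if it acts nontrivially on at most `k` qubits. -/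
def PauliString.IsLocal {n : ℕ} (k : ℕ) (p : PauliString n) : Prop :=
  (Finset.univ.filter fun i => p i ≠ Pauli.I).card ≤ k

/-- Gates of a circuit on `n` system qubits and `a` ancilla qubits, with Pauli operators of
locality at most `k`. The system is only accessed through Pauli operators, which may be controlled
by the ancilla register. -/
inductive Gate (k n a : ℕ) : Type where
  /-- A unitary on the ancilla register alone. -/
  | ancilla (V : Matrix.unitaryGroup (Bits a) ℂ)
  /-- Application of a `k`-local Pauli operator to the system, where the ancilla register selects
  which one: `∑ j, P j ⊗ |j⟩⟨j|`. -/
  | pauli (P : Bits a → PauliString n) (hP : ∀ j, (P j).IsLocal k)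

/-- The operator of a gate on system and ancilla qubits. -/
def Gate.toOp {k n a : ℕ} : Gate k n a → Matrix (Bits n × Bits a) (Bits n × Bits a) ℂ
  | .ancilla V => Matrix.kroneckerMap (fun x y => x * y) (1 : QOp n) (V : QOp a)
  | .pauli P _ => Matrix.blockDiagonal fun j => (P j).toOp

/-- The number of Pauli operators that a gate applies to the system. -/
def Gate.pauliCost {k n a : ℕ} : Gate k n a → ℕ
  | .ancilla _ => 0
  | .pauli _ _ => 1

/-- A quantum circuit: a finite sequence of gates. -/
abbrev Circuit (k n a : ℕ) : Type := List (Gate k n a)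

/-- The unitary of a circuit, as the product of its gates (the last gate of the list acts first). -/
def Circuit.toOp {k n a : ℕ} (Q : Circuit k n a) :
    Matrix (Bits n × Bits a) (Bits n × Bits a) ℂ :=
  (Q.map Gate.toOp).prod

/-- The number of Pauli operators that the circuit applies to the system. -/
def Circuit.pauliCount {k n a : ℕ} (Q : Circuit k n a) : ℕ :=
  (Q.map Gate.pauliCost).sum

/-- The operator `⟨0| Q |0⟩` on the system that the circuit `Q` implements when the ancilla
qubits start and end in the state `|0…0⟩`. -/
def Circuit.systemOp {k n a : ℕ} (Q : Circuit k n a) : QOp n :=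
  Matrix.of fun x y => Q.toOp (x, fun _ => 0) (y, fun _ => 0)

/-- The circuit simulates all matrix elements `⟨u| A |v⟩`, for unit vectors `u`, `v`,
within error `ε`. -/
def Circuit.Simulates {k n a : ℕ} (Q : Circuit k n a) (A : QOp n) (ε : ℝ) : Prop :=
  ∀ u v : QState n, ‖u‖ = 1 → ‖v‖ = 1 → ‖matElem A u v - matElem Q.systemOp u v‖ ≤ ε

/-- `log y / log (log y)`. -/
noncomputable def logRatio (y : ℝ) : ℝ := Real.log y / Real.log (Real.log y)

/-!
The proof follows the truncated Taylor series method with oblivious amplitude amplification.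

A transposition of two qubits is `(II + XX + YY + ZZ) / 2`, of Pauli 1-norm `2`, and a permutation
that moves at most `k` points is a product of at most `k - 1` transpositions of points that it
moves. Since at most `n ^ k` permutations move at most `k` points, `H` is a combination of `k`-local
Pauli strings with coefficients of total weight at most `L n ^ k` (`isCombOf_groupAlgOp`).

Split the evolution into `r = ⌈2 x⌉` segments, where `x = t L n ^ k`. In each of them the total
weight `b` of `-i (t / r) H` is at most `1 / 2`, so that the Taylor polynomial of degree `K` is a
combination of words of `K` Pauli strings of weight at most `exp (1 / 2) ≤ 2`
(`isCombOf_truncated_exp`). Preparing suitable ancilla amplitudes, applying `K` Pauli operators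
selected by the ancillas and undoing a second preparation gives a circuit whose block at the ancilla
state `|0⟩` is exactly half of this polynomial (`exists_circuit_of_isCombOf`). An ancilla basis
state encodes a word, and there are at most `(4 n) ^ k` local Pauli strings, which accounts for
`O(k K log (n + 1))` ancilla qubits.

The polynomial is within `1 / K!` of the unitary `exp (-i (t / r) H)`. For a block that is half of a
unitary, one round of amplification, with three uses of the circuit, restores the unitary
(`norm_amplified_block_sub_le`). A unitary with a nearly unitary block can leak only little out of
the ancilla state `|0⟩` (`norm_mul_projection_sub_le`), with an error `√(10 / K!)`, so that the
segments can be composed with a total error of `r √(10 / K!)`. This is at most `ε` if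
`K! ≥ 90 (x / ε) ^ 2`, which some `K` of size `O(log (x / ε) / log log (x / ε))` satisfies
(`exists_factorial_ge`).
-/

/-! ### Amplitude amplification in a C⋆-algebra -/

section Amplification

variable {A : Type*} [CStarAlgebra A]

/-- Partial isometries, such as unitaries and projections, are contractions. -/
lemma norm_le_one_of_star_mul_self_mul {v : A} (hv : v * star v * v = v) : ‖v‖ ≤ 1 := by
  have h : star v * v * star (star v * v) = star v * v := by
    simp [mul_assoc] at hv ⊢
    simp [hv]
  have h2 : ‖star v * v‖ * ‖star v * v‖ = ‖star v * v‖ := by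
    conv_rhs => rw [← h]
    rw [CStarRing.norm_self_mul_star]
  rw [CStarRing.norm_star_mul_self] at h2
  by_contra! hlt
  nlinarith [mul_pos (by linarith : 0 < ‖v‖) (by linarith : 0 < ‖v‖),
    one_lt_mul_of_lt_of_le hlt hlt.le]

/-- Oblivious amplitude amplification. If the block `p w p` of a unitary `w` is half of a unitary
`u p`, up to an error, then one round of amplification turns it into `u p`: the block of the
amplified operator is `(3 x - x x⋆ x) / 2` with `x = 2 p w p`, which has the fixed point
`x = u p`. -/
lemma norm_amplified_block_sub_le {p w u : A} {δ : ℝ} (hp : IsStarProjection p)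
    (hw : w ∈ unitary A) (hu : u ∈ unitary A) (hδ : δ ≤ 1)
    (h : ‖(2 : ℂ) • (p * w * p) - u * p‖ ≤ δ) :
    ‖p * (w * (2 * p - 1) * star w * (1 - 2 * p) * w) * p - u * p‖ ≤ 5 * δ := by
  have hpp : p * p = p := hp.isIdempotentElem
  have hps : star p = p := hp.isSelfAdjoint
  have hww : w * star w = 1 := (Unitary.mem_iff.mp hw).2
  have huu : star u * u = 1 := (Unitary.mem_iff.mp hu).1
  set v := u * p with hv
  set x := (2 : ℂ) • (p * w * p) with hx
  have hvv : v * star v * v = v := by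
    rw [hv, star_mul, hps]
    calc u * p * (p * star u) * (u * p) = u * (p * p) * (star u * u) * p := by noncomm_ring
      _ = u * p := by rw [huu, hpp, mul_one, mul_assoc, hpp]
  have hv1 : ‖v‖ ≤ 1 := norm_le_one_of_star_mul_self_mul hvv
  have hx2 : ‖x‖ ≤ 2 := by
    calc ‖x‖ = ‖(x - v) + v‖ := by rw [sub_add_cancel]
      _ ≤ ‖x - v‖ + ‖v‖ := norm_add_le _ _
      _ ≤ 2 := by linarith
  have hδ0 : 0 ≤ δ := (norm_nonneg _).trans h
  have hblock : (2 : ℂ) • (p * (w * (2 * p - 1) * star w * (1 - 2 * p) * w) * p)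
      = (3 : ℂ) • x - x * star x * x := by
    have e1 : p * (w * (2 * p - 1) * star w * (1 - 2 * p) * w) * p
        = (3 : ℂ) • (p * w * p) - (4 : ℂ) • (p * w * p * star w * p * w * p) := by
      have : p * (w * (2 * p - 1) * star w * (1 - 2 * p) * w) * p
          = 2 * (p * w * p * (star w) * w * p) - 4 * (p * w * p * star w * p * w * p)
            - p * (w * star w) * w * p + 2 * (p * (w * star w) * p * w * p) := by
        noncomm_ring
      have hww' : star w * w = 1 := (Unitary.mem_iff.mp hw).1
      have e2 : p * w * p * (star w) * w * p = p * w * p := by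
        rw [mul_assoc (p * w * p), hww', mul_one, mul_assoc, hpp]
      rw [this, e2, hww, mul_one, hpp, Algebra.smul_def, Algebra.smul_def, map_ofNat, map_ofNat]
      noncomm_ring
    have e3 : x * star x * x = (8 : ℂ) • (p * w * p * star w * p * w * p) := by
      have : x * star x * x
          = (8 : ℂ) • (p * w * (p * p) * star w * (p * p) * w * p) := by
        simp only [hx, star_smul, star_mul, hps, smul_mul_assoc, mul_smul_comm, smul_smul]
        norm_num
        noncomm_ring
      rw [this, hpp]
    rw [e1, e3, hx, smul_sub, smul_smul, smul_smul, smul_smul]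
    norm_num
  have key : (2 : ℂ) • (p * (w * (2 * p - 1) * star w * (1 - 2 * p) * w) * p - v)
      = (3 : ℂ) • (x - v)
        - ((x - v) * star x * x + v * star (x - v) * x + v * star v * (x - v)) := by
    rw [smul_sub, hblock]
    have : (x - v) * star x * x + v * star (x - v) * x + v * star v * (x - v)
      = x * star x * x - v * star v * v := by rw [star_sub]; noncomm_ring
    rw [this, hvv]
    module
  have n1 : ‖(x - v) * star x * x‖ ≤ δ * 2 * 2 :=
    (norm_mul₃_le).trans (by rw [norm_star]; gcongr)
  have n2 : ‖v * star (x - v) * x‖ ≤ 1 * δ * 2 :=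
    (norm_mul₃_le).trans (by rw [norm_star]; gcongr)
  have n3 : ‖v * star v * (x - v)‖ ≤ 1 * 1 * δ :=
    (norm_mul₃_le).trans (by rw [norm_star]; gcongr)
  have n4 : ‖(3 : ℂ) • (x - v)‖ ≤ 3 * δ := by rw [norm_smul]; norm_num; exact h
  have n5 := congrArg norm key
  rw [norm_smul] at n5
  have n6 := norm_sub_le ((3 : ℂ) • (x - v))
    ((x - v) * star x * x + v * star (x - v) * x + v * star v * (x - v))
  have n7 := norm_add₃_le (a := (x - v) * star x * x) (b := v * star (x - v) * x)
    (c := v * star v * (x - v))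
  rw [Complex.norm_ofNat] at n5
  linarith

/-- A unitary `g` whose block `p g p` is close to the unitary `u p` leaks little out of `p`. -/
lemma norm_mul_projection_sub_le {p g u : A} {η : ℝ} (hp : IsStarProjection p)
    (hg : g ∈ unitary A) (hu : u ∈ unitary A) (hup : Commute u p)
    (h : ‖p * g * p - u * p‖ ≤ η) : ‖g * p - u * p‖ ≤ √(2 * η) := by
  have hpp : p * p = p := hp.isIdempotentElem
  have hps : star p = p := hp.isSelfAdjoint
  have hgg : star g * g = 1 := (Unitary.mem_iff.mp hg).1
  have huu : star u * u = 1 := (Unitary.mem_iff.mp hu).1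
  have hu1 : ‖u‖ ≤ 1 := norm_le_one_of_star_mul_self_mul (by rw [mul_assoc, huu, mul_one])
  set e := p * g * p - u * p with he
  have key : star (g * p - u * p) * (g * p - u * p) = -(star e * u) - star u * e := by
    have hup' : u * p = p * u := hup
    have hup'' : p * star u = star u * p := by
      have := congrArg star hup'
      simpa [hps] using this
    have l : star (g * p - u * p) * (g * p - u * p)
        = p * (star g * g) * p - p * star g * (u * p) - p * star u * g * p
          + p * (star u * u) * p := by
      simp only [star_sub, star_mul, hps]; noncomm_ring
    have r : -(star e * u) - star u * e
        = -(p * star g * (p * u)) + p * (star u * u) - (star u * p) * g * p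
          + (star u * u) * p := by
      simp only [he, star_sub, star_mul, hps]; noncomm_ring
    rw [l, r, hgg, huu, ← hup', ← hup'', mul_one, hpp, one_mul]
    abel
  have hn : ‖g * p - u * p‖ * ‖g * p - u * p‖ ≤ 2 * η := by
    rw [← CStarRing.norm_star_mul_self, key]
    calc ‖-(star e * u) - star u * e‖ ≤ ‖-(star e * u)‖ + ‖star u * e‖ := norm_sub_le _ _
      _ ≤ ‖star e‖ * ‖u‖ + ‖star u‖ * ‖e‖ := by
        rw [norm_neg]; gcongr <;> exact norm_mul_le _ _
      _ ≤ η * 1 + 1 * η := by rw [norm_star, norm_star]; gcongr; exact (norm_nonneg _).trans h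
      _ = 2 * η := by ring
  exact Real.le_sqrt_of_sq_le (by rw [sq]; exact hn)

lemma norm_pow_mul_projection_sub_le {p g u : A} {η : ℝ}
    (hg : g ∈ unitary A) (hu : u ∈ unitary A) (hup : Commute u p)
    (h : ‖g * p - u * p‖ ≤ η) (r : ℕ) : ‖g ^ r * p - u ^ r * p‖ ≤ r * η := by
  induction r with
  | zero => simp
  | succ r ih =>
    have hg1 : ‖g‖ ≤ 1 := norm_le_one_of_star_mul_self_mul
      (by rw [mul_assoc, (Unitary.mem_iff.mp hg).1, mul_one])
    have hu1 : ‖u ^ r‖ ≤ 1 := norm_le_one_of_star_mul_self_mul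
      (by rw [mul_assoc, (Unitary.mem_iff.mp (pow_mem hu r)).1, mul_one])
    have e : g ^ (r + 1) * p - u ^ (r + 1) * p
        = g * (g ^ r * p - u ^ r * p) + (g * p - u * p) * u ^ r := by
      have h1 : p * u ^ r = u ^ r * p := ((hup.pow_left r).eq).symm
      rw [sub_mul, mul_assoc g p, mul_assoc u p, h1, pow_succ' g, pow_succ' u]
      noncomm_ring
    rw [e]
    calc _ ≤ ‖g‖ * ‖g ^ r * p - u ^ r * p‖ + ‖g * p - u * p‖ * ‖u ^ r‖ :=
          (norm_add_le _ _).trans (add_le_add (norm_mul_le _ _) (norm_mul_le _ _))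
      _ ≤ 1 * (r * η) + η * 1 := by
          gcongr
          exact (norm_nonneg _).trans h
      _ = _ := by push_cast; ring

end Amplification

/-! ### Truncation of the exponential series -/

lemma norm_exp_sub_sum_range_le {A : Type*} [NormedRing A] [NormedAlgebra ℂ A] [CompleteSpace A]
    {x : A} (hx : ‖x‖ ≤ 1 / 2) (K : ℕ) :
    ‖NormedSpace.exp x - ∑ m ∈ Finset.range (K + 1), ((m.factorial : ℂ)⁻¹) • x ^ m‖
      ≤ 1 / K.factorial := by
  have hs : HasSum (fun m : ℕ => ((m.factorial : ℂ)⁻¹) • x ^ m) (NormedSpace.exp x) :=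
    NormedSpace.exp_series_hasSum_exp' (𝕂 := ℂ) x
  rw [← hs.tsum_eq, ← hs.summable.sum_add_tsum_nat_add (K + 1), add_sub_cancel_left]
  refine tsum_of_norm_bounded (g := fun m : ℕ => (1 / K.factorial) * ((1 / 2 : ℝ) / 2 ^ m)) ?_ ?_
  · simpa using (hasSum_geometric_two' (1 : ℝ)).mul_left (1 / (K.factorial : ℝ))
  · intro m
    rw [norm_smul, norm_inv, Complex.norm_natCast]
    have h1 : ‖x ^ (m + (K + 1))‖ ≤ (1 / 2 : ℝ) ^ (m + (K + 1)) :=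
      (norm_pow_le' x (by omega)).trans (by gcongr)
    have h2 : (1 / 2 : ℝ) ^ (m + (K + 1)) ≤ (1 / 2 : ℝ) ^ (m + 1) :=
      pow_le_pow_of_le_one (by norm_num) (by norm_num) (by omega)
    have h3 : (K.factorial : ℝ) ≤ (m + (K + 1)).factorial := by
      exact_mod_cast Nat.factorial_le (by omega)
    have h4 : (0 : ℝ) < K.factorial := by positivity
    calc _ ≤ (K.factorial : ℝ)⁻¹ * (1 / 2 : ℝ) ^ (m + 1) := by gcongr; exact h1.trans h2
      _ = _ := by rw [pow_succ, one_div_pow]; field_simp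

/-! ### The truncation order -/

lemma one_le_logRatio {y : ℝ} (hy : Real.exp 1 < y) : 1 ≤ logRatio y := by
  have h1 : 1 < Real.log y := by
    rwa [Real.lt_log_iff_exp_lt ((Real.exp_pos 1).trans hy)]
  have h2 : 0 < Real.log (Real.log y) := Real.log_pos h1
  rw [logRatio, one_le_div h2]
  linarith [Real.log_le_sub_one_of_pos (by linarith : 0 < Real.log y)]

/-- A multiple of `log y / log log y` is a sufficient truncation order, since
`log K! ≥ K (log K - 1)`. The factor `90 = 10 * 3 ^ 2` comes from the leakage error `√(10 / K!)` of
a segment and the number of segments, at most `3 x`. -/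
lemma exists_factorial_ge {y : ℝ} (hy : Real.exp 1 < y) :
    ∃ K : ℕ, 90 * y ^ 2 ≤ K.factorial ∧ (K : ℝ) ≤ 11 * logRatio y := by
  have hy0 : 0 < y := (Real.exp_pos 1).trans hy
  have hl1 : 1 < Real.log y := by rwa [Real.lt_log_iff_exp_lt hy0]
  have hq : 0 < Real.log (Real.log y) := Real.log_pos hl1
  have hR := one_le_logRatio hy
  set l := Real.log y with hl
  set q := Real.log l with hqdef
  set z := 10 * logRatio y with hz
  have hzq : z * q = 10 * l := by
    rw [hz, logRatio, ← hl, ← hqdef]; field_simp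
  have hz10 : 10 ≤ z := by linarith
  refine ⟨⌈z⌉₊, ?_, ?_⟩
  swap
  · have := (Nat.ceil_lt_add_one (by linarith : 0 ≤ z)).le
    linarith
  set K := ⌈z⌉₊ with hK
  have hzK : z ≤ K := Nat.le_ceil z
  have hK0 : (0 : ℝ) < K := by linarith
  have hlogz : Real.log z = Real.log 10 + q - Real.log q := by
    have : z = 10 * l / q := by rw [← hzq]; field_simp
    rw [this, Real.log_div (by positivity) hq.ne', Real.log_mul (by norm_num) (by positivity)]
  have hlogq : Real.log q ≤ q / 2 := by
    have h1 : Real.log (q / 2) ≤ q / 2 - 1 := Real.log_le_sub_one_of_pos (by positivity)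
    rw [Real.log_div hq.ne' (by norm_num)] at h1
    linarith [Real.log_two_lt_d9]
  have hlog2 := Real.log_two_gt_d9
  have hlog10 : 2 ≤ Real.log 10 := by
    have : Real.log (2 ^ 3) ≤ Real.log 10 := Real.log_le_log (by norm_num) (by norm_num)
    rw [Real.log_pow] at this
    push_cast at this
    linarith
  have hlog90 : Real.log 90 ≤ 7 := by
    have : Real.log 90 ≤ Real.log (2 ^ 7) := Real.log_le_log (by norm_num) (by norm_num)
    rw [Real.log_pow] at this
    push_cast at this
    linarith [Real.log_two_lt_d9]
  have hzK' : z * (Real.log z - 1) ≤ K * (Real.log K - 1) := by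
    have h1 : Real.log z ≤ Real.log K := Real.log_le_log (by linarith) hzK
    have h2 : 0 ≤ Real.log z - 1 := by rw [hlogz]; linarith
    nlinarith
  have hfac : K * (Real.log K - 1) ≤ Real.log K.factorial := by
    have h1 := Real.pow_div_factorial_le_exp (K : ℝ) hK0.le K
    have h2 : Real.log ((K : ℝ) ^ K / K.factorial) ≤ K :=
      (Real.log_le_iff_le_exp (div_pos (pow_pos hK0 K) (by positivity))).mpr h1
    rw [Real.log_div (pow_pos hK0 K).ne' (by positivity), Real.log_pow] at h2
    linarith
  have hmain : Real.log (90 * y ^ 2) ≤ Real.log K.factorial := by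
    rw [Real.log_mul (by norm_num) (by positivity), Real.log_pow]
    refine le_trans ?_ (hzK'.trans hfac)
    have : z * (1 + q / 2) ≤ z * (Real.log z - 1) := by
      apply mul_le_mul_of_nonneg_left _ (by linarith)
      rw [hlogz]; linarith
    push_cast
    nlinarith
  exact (Real.log_le_log_iff (by positivity) (by positivity)).mp hmain

/-! ### Linear combinations with bounded coefficients -/

/-- `x` is a linear combination of the family `f` whose coefficients have absolute values of sum
at most `s`. -/
def IsCombOf {J M : Type*} [Fintype J] [AddCommGroup M] [Module ℂ M] (f : J → M) (s : ℝ)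
    (x : M) : Prop :=
  ∃ w : J → ℂ, ∑ j, ‖w j‖ ≤ s ∧ x = ∑ j, w j • f j

namespace IsCombOf

variable {I J M : Type*} [Fintype I] [Fintype J] [AddCommGroup M] [Module ℂ M]
  {f : J → M} {g : I → M} {s s' : ℝ} {x y : M}

lemma mono (h : IsCombOf f s x) (hs : s ≤ s') : IsCombOf f s' x :=
  let ⟨w, hw, e⟩ := h
  ⟨w, hw.trans hs, e⟩

lemma of_apply (f : J → M) (j : J) : IsCombOf f 1 (f j) := by
  classical
  refine ⟨Pi.single j 1, ?_, ?_⟩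
  · simp [Pi.single_apply, apply_ite norm]
  · simp [Pi.single_apply]

protected lemma zero (f : J → M) : IsCombOf f 0 0 := ⟨0, by simp, by simp⟩

protected lemma add (h : IsCombOf f s x) (h' : IsCombOf f s' y) : IsCombOf f (s + s') (x + y) := by
  obtain ⟨w, hw, rfl⟩ := h
  obtain ⟨w', hw', rfl⟩ := h'
  refine ⟨w + w', ?_, by simp [add_smul, Finset.sum_add_distrib]⟩
  calc ∑ j, ‖(w + w') j‖ ≤ ∑ j, (‖w j‖ + ‖w' j‖) := by
        gcongr with j; exact norm_add_le _ _
    _ ≤ s + s' := by rw [Finset.sum_add_distrib]; gcongr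

protected lemma smul (h : IsCombOf f s x) (a : ℂ) : IsCombOf f (‖a‖ * s) (a • x) := by
  obtain ⟨w, hw, rfl⟩ := h
  refine ⟨a • w, ?_, by simp [Finset.smul_sum, smul_smul]⟩
  simp only [Pi.smul_apply, smul_eq_mul, norm_mul, ← Finset.mul_sum]
  gcongr

protected lemma sum {ι : Type*} (t : Finset ι) {s : ι → ℝ} {x : ι → M}
    (h : ∀ i ∈ t, IsCombOf f (s i) (x i)) : IsCombOf f (∑ i ∈ t, s i) (∑ i ∈ t, x i) := by
  classical
  induction t using Finset.induction_on with
  | empty => simpa using IsCombOf.zero f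
  | insert i t hi ih =>
    rw [Finset.sum_insert hi, Finset.sum_insert hi]
    exact (h i (by simp)).add (ih fun j hj => h j (by simp [hj]))

lemma trans (h : IsCombOf f s x) (hfg : ∀ j, IsCombOf g 1 (f j)) : IsCombOf g s x := by
  obtain ⟨w, hw, rfl⟩ := h
  refine (IsCombOf.sum Finset.univ (s := fun j => ‖w j‖ * 1) fun j _ => (hfg j).smul (w j)).mono ?_
  simpa using hw

lemma norm_le {M : Type*} [NormedAddCommGroup M] [NormedSpace ℂ M] {f : J → M} {x : M}
    (h : IsCombOf f s x) (hf : ∀ j, ‖f j‖ ≤ 1) : ‖x‖ ≤ s := by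
  obtain ⟨w, hw, rfl⟩ := h
  refine (norm_sum_le _ _).trans (le_trans ?_ hw)
  gcongr with j
  rw [norm_smul]
  exact mul_le_of_le_one_right (norm_nonneg _) (hf j)

lemma mul {I' R : Type*} [Fintype I'] [Ring R] [Algebra ℂ R] {f : J → R} {f' : I → R}
    {g : I' → R} {x y : R} (h : IsCombOf f s x) (h' : IsCombOf f' s' y)
    (hfg : ∀ i j, IsCombOf g 1 (f i * f' j)) : IsCombOf g (s * s') (x * y) := by
  obtain ⟨w, hw, rfl⟩ := h
  obtain ⟨w', hw', rfl⟩ := h'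
  rw [Finset.sum_mul_sum]
  have := IsCombOf.sum (f := g) Finset.univ (s := fun j => ∑ i, ‖w j * w' i‖ * 1)
    (x := fun j => ∑ i, w j • f j * w' i • f' i) fun j _ => by
      refine IsCombOf.sum Finset.univ fun i _ => ?_
      rw [smul_mul_smul_comm]
      exact (hfg j i).smul _
  refine this.mono ?_
  simp only [mul_one, norm_mul, ← Finset.sum_mul_sum]
  have : 0 ≤ s := (Finset.sum_nonneg fun j _ => norm_nonneg (w j)).trans hw
  gcongr

end IsCombOf

/-! ### Pauli strings -/

instance : Fintype Pauli := ⟨{.I, .X, .Y, .Z}, fun p => by cases p <;> simp⟩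

lemma card_pauli : Fintype.card Pauli = 4 := rfl

/-- The product of two Pauli matrices, up to the phase `Pauli.phase`. -/
def Pauli.mul : Pauli → Pauli → Pauli
  | .I, q => q
  | p, .I => p
  | .X, .X => .I
  | .Y, .Y => .I
  | .Z, .Z => .I
  | .X, .Y => .Z
  | .Y, .X => .Z
  | .Y, .Z => .X
  | .Z, .Y => .X
  | .Z, .X => .Y
  | .X, .Z => .Y

/-- The phase that appears in the product of two Pauli matrices. -/
noncomputable def Pauli.phase : Pauli → Pauli → ℂ
  | .X, .Y => Complex.I
  | .Y, .X => -Complex.I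
  | .Y, .Z => Complex.I
  | .Z, .Y => -Complex.I
  | .Z, .X => Complex.I
  | .X, .Z => -Complex.I
  | _, _ => 1

lemma Pauli.norm_phase (p q : Pauli) : ‖p.phase q‖ = 1 := by
  cases p <;> cases q <;> simp [Pauli.phase]

lemma Pauli.toMatrix_mul (p q : Pauli) :
    p.toMatrix * q.toMatrix = p.phase q • (p.mul q).toMatrix := by
  cases p <;> cases q <;> ext i j <;> fin_cases i <;> fin_cases j <;>
    simp [Pauli.toMatrix, Pauli.phase, Pauli.mul]

lemma Pauli.toMatrix_conjTranspose (p : Pauli) : p.toMatrix.conjTranspose = p.toMatrix := by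
  cases p <;> ext i j <;> fin_cases i <;> fin_cases j <;> simp [Pauli.toMatrix]

lemma Pauli.toMatrix_I_apply (a b : Fin 2) : Pauli.I.toMatrix a b = if a = b then 1 else 0 := by
  fin_cases a <;> fin_cases b <;> simp [Pauli.toMatrix]

namespace PauliString

variable {n : ℕ}

lemma toOp_mul (p q : PauliString n) :
    p.toOp * q.toOp = (∏ i, (p i).phase (q i)) • toOp fun i => (p i).mul (q i) := by
  ext x y
  have h : ∀ i, (p i).phase (q i) * ((p i).mul (q i)).toMatrix (x i) (y i)
      = ∑ z, (p i).toMatrix (x i) z * (q i).toMatrix z (y i) := fun i => by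
    rw [← Matrix.mul_apply, Pauli.toMatrix_mul, Matrix.smul_apply, smul_eq_mul]
  simp only [toOp, Matrix.mul_apply, Matrix.smul_apply, Matrix.of_apply, smul_eq_mul,
    ← Finset.prod_mul_distrib, h, Finset.prod_univ_sum, Fintype.piFinset_univ]

lemma toOp_one : toOp (fun _ : Fin n => Pauli.I) = 1 := by
  ext x y
  simp only [toOp, Matrix.of_apply, Pauli.toMatrix_I_apply, Finset.prod_ite_zero, Matrix.one_apply,
    funext_iff]
  simp

lemma toOp_conjTranspose (p : PauliString n) : p.toOp.conjTranspose = p.toOp := by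
  ext x y
  simp only [toOp, Matrix.conjTranspose_apply, Matrix.of_apply, star_prod]
  refine Finset.prod_congr rfl fun i _ => ?_
  rw [← Matrix.conjTranspose_apply, Pauli.toMatrix_conjTranspose]

lemma toOp_mul_self (p : PauliString n) : p.toOp * p.toOp = 1 := by
  rw [toOp_mul, ← toOp_one]
  have h1 : ∀ a : Pauli, a.phase a = 1 := fun a => by cases a <;> rfl
  have h2 : ∀ a : Pauli, a.mul a = .I := fun a => by cases a <;> rfl
  simp [h1, h2]

open scoped Matrix.Norms.L2Operator in
lemma norm_toOp_le (p : PauliString n) : ‖p.toOp‖ ≤ 1 := by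
  apply norm_le_one_of_star_mul_self_mul
  rw [Matrix.star_eq_conjTranspose, toOp_conjTranspose, toOp_mul_self, one_mul]

end PauliString

/-- `M` is a combination of Pauli strings that act trivially outside `S`, with coefficients of
total weight at most `s`. -/
def IsPauliComb {n : ℕ} (S : Finset (Fin n)) (s : ℝ) (M : QOp n) : Prop :=
  IsCombOf (fun p : {p : PauliString n // ∀ i, i ∉ S → p i = Pauli.I} => p.1.toOp) s M

namespace IsPauliComb

variable {n : ℕ} {S S' : Finset (Fin n)} {s s' : ℝ} {M M' : QOp n}

lemma toOp (p : PauliString n) (hp : ∀ i, i ∉ S → p i = Pauli.I) : IsPauliComb S 1 p.toOp :=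
  IsCombOf.of_apply
    (fun p : {p : PauliString n // ∀ i, i ∉ S → p i = Pauli.I} => p.1.toOp) ⟨p, hp⟩

lemma mono_set (h : IsPauliComb S s M) (hS : S ⊆ S') : IsPauliComb S' s M :=
  h.trans fun p => toOp p.1 fun i hi => p.2 i fun hi' => hi (hS hi')

protected lemma mul (h : IsPauliComb S s M) (h' : IsPauliComb S s' M') :
    IsPauliComb S (s * s') (M * M') := by
  refine IsCombOf.mul h h' fun p q => ?_
  rw [PauliString.toOp_mul]
  refine ((toOp (S := S) (fun i => (p.1 i).mul (q.1 i)) fun i hi => ?_).smul _).mono ?_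
  · rw [p.2 i hi, q.2 i hi]; rfl
  · simp [norm_prod, Pauli.norm_phase]

protected lemma one : IsPauliComb S 1 1 := by
  rw [← PauliString.toOp_one]
  exact toOp _ fun _ _ => rfl

end IsPauliComb

/-! ### Permutations as combinations of Pauli strings -/

section Permutations

variable {n : ℕ}

lemma permOp_mul (σ τ : Equiv.Perm (Fin n)) : permOp σ * permOp τ = permOp (σ * τ) := by
  ext x y
  simp only [permOp, Matrix.mul_apply, Matrix.of_apply, mul_ite, mul_one, mul_zero,
    Finset.sum_ite_eq', Finset.mem_univ, if_true]
  rw [Function.comp_assoc, ← Equiv.Perm.coe_mul, mul_inv_rev]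

lemma permOp_one : permOp (1 : Equiv.Perm (Fin n)) = 1 := by
  ext x y
  simp [permOp, Matrix.one_apply]

/-- The Pauli string with the factor `a` at the positions `i` and `j`. -/
def PauliString.pair (i j : Fin n) (a : Pauli) : PauliString n :=
  fun l => if l = i ∨ l = j then a else .I

lemma permOp_swap {i j : Fin n} (hij : i ≠ j) :
    permOp (Equiv.swap i j) = ∑ a : Pauli, (1 / 2 : ℂ) • (PauliString.pair i j a).toOp := by
  ext x y
  have h2 : ∀ a : Pauli, (PauliString.pair i j a).toOp x y
      = (a.toMatrix (x i) (y i) * a.toMatrix (x j) (y j)) *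
        if ∀ l ∈ (Finset.univ.erase i).erase j, x l = y l then 1 else 0 := fun a => by
    rw [PauliString.toOp, Matrix.of_apply, ← Finset.mul_prod_erase _ _ (Finset.mem_univ i),
      ← Finset.mul_prod_erase _ _ (show j ∈ Finset.univ.erase i by simp [hij.symm]), ← mul_assoc]
    congr 1
    · simp [PauliString.pair]
    · trans ∏ l ∈ (Finset.univ.erase i).erase j, if x l = y l then (1 : ℂ) else 0
      swap
      · simp only [Finset.prod_ite_zero, Finset.prod_const_one]
      refine Finset.prod_congr rfl fun l hl => ?_
      simp only [Finset.mem_erase, Finset.mem_univ, and_true] at hl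
      rw [PauliString.pair, if_neg (by tauto), Pauli.toMatrix_I_apply]
  have h1 : x = y ∘ ((Equiv.swap i j)⁻¹ : Equiv.Perm (Fin n)) ↔
      (x i = y j ∧ x j = y i) ∧ ∀ l ∈ (Finset.univ.erase i).erase j, x l = y l := by
    rw [Equiv.swap_inv, funext_iff]
    constructor
    · intro h
      refine ⟨⟨by simpa using h i, by simpa using h j⟩, fun l hl => ?_⟩
      simp only [Finset.mem_erase, Finset.mem_univ, and_true] at hl
      simpa [Equiv.swap_apply_of_ne_of_ne hl.2 hl.1] using h l
    · rintro ⟨⟨hi, hj⟩, h⟩ l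
      by_cases hli : l = i
      · subst hli; simpa using hi
      by_cases hlj : l = j
      · subst hlj; simpa using hj
      simpa [Equiv.swap_apply_of_ne_of_ne hli hlj] using h l (by simp [hli, hlj])
  have h3 : ∀ a b c d : Fin 2, ∑ p : Pauli, (1 / 2 : ℂ) * (p.toMatrix a b * p.toMatrix c d)
      = if a = d ∧ c = b then 1 else 0 := fun a b c d => by
    have : (Finset.univ : Finset Pauli) = {.I, .X, .Y, .Z} := rfl
    rw [this]
    fin_cases a <;> fin_cases b <;> fin_cases c <;> fin_cases d <;>
      simp [Pauli.toMatrix] <;> norm_num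
  rw [permOp, Matrix.of_apply, if_congr h1 rfl rfl, Matrix.sum_apply]
  simp only [Matrix.smul_apply, smul_eq_mul, h2, ← mul_assoc, ← Finset.sum_mul]
  simp only [mul_assoc, h3, ite_and]
  split_ifs <;> simp

lemma isPauliComb_permOp_swap {i j : Fin n} (hij : i ≠ j) :
    IsPauliComb {i, j} 2 (permOp (Equiv.swap i j)) := by
  rw [permOp_swap hij]
  refine (IsCombOf.sum Finset.univ fun a _ =>
    (IsPauliComb.toOp (PauliString.pair i j a) ?_).smul (1 / 2)).mono ?_
  · intro l hl
    simp only [Finset.mem_insert, Finset.mem_singleton] at hl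
    simp [PauliString.pair, hl]
  · simp [card_pauli]; norm_num

/-- A permutation that moves `m` points is a product of at most `m - 1` transpositions, and each of
them is `(I + XX + YY + ZZ) / 2`. -/
lemma isPauliComb_permOp (σ : Equiv.Perm (Fin n)) :
    IsPauliComb σ.support (2 ^ (σ.support.card - 1)) (permOp σ) := by
  induction h : σ.support.card using Nat.strong_induction_on generalizing σ with
  | _ m ih =>
    subst h
    by_cases hσ : σ = 1
    · subst hσ
      rw [permOp_one]
      simpa using IsPauliComb.one
    · obtain ⟨i, hi⟩ : ∃ i, σ i ≠ i := by
        by_contra! h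
        exact hσ (Equiv.ext h)
      have hlt := Equiv.Perm.card_support_swap_mul hi
      set τ := Equiv.swap i (σ i) * σ with hτ
      have hστ : σ = Equiv.swap i (σ i) * τ := by rw [hτ, Equiv.swap_mul_self_mul]
      have hsub : τ.support ⊆ σ.support := by
        intro l hl
        by_contra hl'
        have h1 : σ l = l := by simpa using hl'
        have h2 : l ≠ i := by rintro rfl; exact hi h1
        have h3 : l ≠ σ i := by
          intro h; rw [h] at h1; exact hi (σ.injective h1)
        rw [Equiv.Perm.mem_support] at hl
        apply hl
        rw [hτ, Equiv.Perm.mul_apply, h1, Equiv.swap_apply_of_ne_of_ne h2 h3]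
      have hpair : ({i, σ i} : Finset (Fin n)) ⊆ σ.support := by
        intro l hl
        simp only [Finset.mem_insert, Finset.mem_singleton] at hl
        rcases hl with rfl | rfl <;> simp [hi]
      have hcard : 2 ≤ σ.support.card := Equiv.Perm.two_le_card_support_of_ne_one hσ
      have := ((isPauliComb_permOp_swap hi.symm).mono_set hpair).mul
        ((ih _ hlt τ rfl).mono_set hsub)
      rw [permOp_mul, ← hστ] at this
      refine IsCombOf.mono this ?_
      rw [← pow_succ']
      exact pow_le_pow_right₀ (by norm_num) (by omega)

lemma card_support_subset_le (S : Finset (Fin n)) :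
    (Finset.univ.filter fun σ : Equiv.Perm (Fin n) => σ.support ⊆ S).card ≤ S.card.factorial := by
  rw [← Fintype.card_subtype, ← Fintype.card_coe S, ← Fintype.card_perm]
  refine Fintype.card_le_of_injective
    (fun σ => (Equiv.Perm.subtypeEquivSubtypePerm (· ∈ S)).symm
      ⟨σ.1, fun a ha => by
        by_contra h
        exact ha (σ.2 (Equiv.Perm.mem_support.mpr h))⟩) ?_
  intro σ τ h
  have := (Equiv.Perm.subtypeEquivSubtypePerm (· ∈ S)).symm.injective h
  simpa [Subtype.ext_iff] using this

/-- Every permutation that moves at most `k ≤ n` points fixes the complement of some set of size `k`,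
and `k! * (n choose k) ≤ n ^ k`. -/
lemma card_perm_support_card_le {n : ℕ} (hn : 1 ≤ n) (k : ℕ) :
    (Finset.univ.filter fun σ : Equiv.Perm (Fin n) => σ.support.card ≤ k).card ≤ n ^ k := by
  rcases le_total k n with hkn | hkn
  · have hsub : (Finset.univ.filter fun σ : Equiv.Perm (Fin n) => σ.support.card ≤ k) ⊆
        (Finset.powersetCard k Finset.univ).biUnion fun S =>
          Finset.univ.filter fun σ : Equiv.Perm (Fin n) => σ.support ⊆ S := by
      intro σ hσ
      simp only [Finset.mem_filter, Finset.mem_univ, true_and] at hσ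
      obtain ⟨S, hS, hSc⟩ := Finset.exists_superset_card_eq hσ (by simpa using hkn)
      simp only [Finset.mem_biUnion, Finset.mem_powersetCard, Finset.mem_filter, Finset.mem_univ,
        true_and]
      exact ⟨S, ⟨Finset.subset_univ _, hSc⟩, hS⟩
    refine (Finset.card_le_card hsub).trans (Finset.card_biUnion_le.trans ?_)
    calc _ ≤ ∑ S ∈ Finset.powersetCard k (Finset.univ : Finset (Fin n)), k.factorial := by
          refine Finset.sum_le_sum fun S hS => ?_
          rw [← (Finset.mem_powersetCard.mp hS).2]
          exact card_support_subset_le S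
      _ = n.descFactorial k := by
          rw [Finset.sum_const, Finset.card_powersetCard, Finset.card_univ, Fintype.card_fin,
            smul_eq_mul, Nat.descFactorial_eq_factorial_mul_choose, mul_comm]
      _ ≤ n ^ k := Nat.descFactorial_le_pow n k
  · calc _ ≤ Fintype.card (Equiv.Perm (Fin n)) := Finset.card_le_univ _
        _ = n.factorial := by simp [Fintype.card_perm]
        _ ≤ n ^ n := Nat.factorial_le_pow n
        _ ≤ n ^ k := Nat.pow_le_pow_right hn hkn

end Permutations

/-! ### Local Pauli strings -/

/-- The `k`-local Pauli strings on `n` qubits. -/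
abbrev LocalPauli (k n : ℕ) : Type := {p : PauliString n // p.IsLocal k}

noncomputable instance (k n : ℕ) : Fintype (LocalPauli k n) := Fintype.ofFinite _

instance (k n : ℕ) : Inhabited (LocalPauli k n) :=
  ⟨⟨fun _ => .I, by simp [PauliString.IsLocal]⟩⟩

/-- A `k`-local Pauli string is determined by a list of `k` positions and the factors there. -/
lemma card_localPauli_le {k n : ℕ} (hn : 1 ≤ n) :
    Fintype.card (LocalPauli k n) ≤ (4 * n) ^ k := by
  classical
  have hcode : ∀ p : LocalPauli k n, ∃ e : Fin k → Fin n, ∀ i, p.1 i ≠ .I → ∃ r, e r = i := by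
    intro p
    obtain ⟨S, hS⟩ : ∃ S, S = Finset.univ.filter fun i => p.1 i ≠ Pauli.I := ⟨_, rfl⟩
    have hc : S.card ≤ k := hS ▸ p.2
    refine ⟨fun r => if h : r.1 < S.card then (S.equivFin.symm ⟨r.1, h⟩).1 else ⟨0, hn⟩,
      fun i hi => ?_⟩
    have hi' : i ∈ S := by simp [hS, hi]
    refine ⟨⟨(S.equivFin ⟨i, hi'⟩).1, lt_of_lt_of_le (S.equivFin ⟨i, hi'⟩).2 hc⟩, ?_⟩
    simp
  choose e he using hcode
  have hinj : Function.Injective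
      fun (p : LocalPauli k n) (r : Fin k) => ((e p r, p.1 (e p r)) : Fin n × Pauli) := by
    intro p q h
    have h1 : ∀ r, e p r = e q r := fun r => congrArg Prod.fst (congrFun h r)
    have h2 : ∀ r, p.1 (e p r) = q.1 (e q r) := fun r => congrArg Prod.snd (congrFun h r)
    ext i
    by_cases hp : p.1 i = .I
    · by_cases hq : q.1 i = .I
      · rw [hp, hq]
      · obtain ⟨r, rfl⟩ := he q i hq
        rw [← h2, h1]
    · obtain ⟨r, rfl⟩ := he p i hp
      rw [h2, h1]
  refine (Fintype.card_le_of_injective _ hinj).trans_eq ?_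
  simp [card_pauli, mul_comm]

lemma norm_le_maxCoeff {n : ℕ} (c : Equiv.Perm (Fin n) → ℂ) (σ : Equiv.Perm (Fin n)) :
    ‖c σ‖ ≤ maxCoeff c :=
  Finset.le_sup' (fun σ => ‖c σ‖) (Finset.mem_univ σ)

/-- The Pauli 1-norm of a `k`-local element of the group algebra. -/
lemma isCombOf_groupAlgOp {n k : ℕ} {c : Equiv.Perm (Fin n) → ℂ} (hn : 1 ≤ n)
    (hc : IsLocalElement k c) :
    IsCombOf (fun p : LocalPauli k n => p.1.toOp) (2 ^ (k - 1) * maxCoeff c * (n : ℝ) ^ k)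
      (groupAlgOp c) := by
  have hC : 0 ≤ maxCoeff c := (norm_nonneg _).trans (norm_le_maxCoeff c 1)
  have e : groupAlgOp c =
      ∑ σ ∈ Finset.univ.filter fun σ : Equiv.Perm (Fin n) => σ.support.card ≤ k,
        c σ • permOp σ := by
    rw [groupAlgOp, eq_comm]
    refine Finset.sum_subset (Finset.filter_subset _ _) fun σ _ hσ => ?_
    rw [not_imp_comm.mp (hc σ) (by simpa using hσ), zero_smul]
  rw [e]
  have h := IsCombOf.sum (f := fun p : LocalPauli k n => p.1.toOp)
    (Finset.univ.filter fun σ : Equiv.Perm (Fin n) => σ.support.card ≤ k)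
    (s := fun _ => maxCoeff c * 2 ^ (k - 1)) (x := fun σ => c σ • permOp σ) fun σ hσ => by
      have hσ' : σ.support.card ≤ k := by simpa using hσ
      have h1 : IsCombOf (fun p : LocalPauli k n => p.1.toOp) (2 ^ (σ.support.card - 1))
          (permOp σ) := (isPauliComb_permOp σ).trans fun p =>
        IsCombOf.of_apply (fun p : LocalPauli k n => p.1.toOp) ⟨p.1, by
          refine (Finset.card_le_card fun i hi => ?_).trans hσ'
          by_contra h
          exact (Finset.mem_filter.mp hi).2 (p.2 i h)⟩
      refine (h1.smul (c σ)).mono ?_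
      gcongr
      · exact norm_le_maxCoeff c σ
      · norm_num
  refine h.mono ?_
  rw [Finset.sum_const, nsmul_eq_mul]
  have : ((Finset.univ.filter fun σ : Equiv.Perm (Fin n) => σ.support.card ≤ k).card : ℝ)
      ≤ (n : ℝ) ^ k := by exact_mod_cast card_perm_support_card_le hn k
  calc _ ≤ (n : ℝ) ^ k * (maxCoeff c * 2 ^ (k - 1)) := by gcongr
    _ = _ := by ring

/-! ### Words of Pauli strings and the truncated exponential -/

/-- The product of a word of `K` local Pauli strings. -/
noncomputable def pauliWord {k n K : ℕ} (j : Fin K → LocalPauli k n) : QOp n :=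
  (List.ofFn fun i => (j i).1.toOp).prod

section Words

variable {k n K : ℕ} {b s : ℝ} {B M : QOp n}

lemma pauliWord_cons (p : LocalPauli k n) (j : Fin K → LocalPauli k n) :
    pauliWord (Fin.cons p j : Fin (K + 1) → LocalPauli k n) = p.1.toOp * pauliWord j := by
  simp [pauliWord, List.ofFn_succ]

lemma isCombOf_pauliWord_mul (hB : IsCombOf (fun p : LocalPauli k n => p.1.toOp) b B)
    (hM : IsCombOf (pauliWord : (Fin K → LocalPauli k n) → QOp n) s M) :
    IsCombOf (pauliWord : (Fin (K + 1) → LocalPauli k n) → QOp n) (b * s) (B * M) := by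
  refine hB.mul hM fun p j => ?_
  rw [← pauliWord_cons]
  exact IsCombOf.of_apply _ _

lemma isCombOf_pauliWord_succ
    (hM : IsCombOf (pauliWord : (Fin K → LocalPauli k n) → QOp n) s M) :
    IsCombOf (pauliWord : (Fin (K + 1) → LocalPauli k n) → QOp n) s M := by
  refine hM.trans fun j => ?_
  have : pauliWord j = pauliWord (Fin.cons default j : Fin (K + 1) → LocalPauli k n) := by
    rw [pauliWord_cons]
    exact (by rw [show (default : LocalPauli k n).1.toOp = 1 from PauliString.toOp_one, one_mul])
  rw [this]
  exact IsCombOf.of_apply _ _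

lemma isCombOf_pauliWord_pow
    (hB : IsCombOf (fun p : LocalPauli k n => p.1.toOp) b B) (K : ℕ) :
    IsCombOf (pauliWord : (Fin K → LocalPauli k n) → QOp n) (b ^ K) (B ^ K) := by
  induction K with
  | zero =>
    have : (B ^ 0) = pauliWord (k := k) (Fin.elim0 : Fin 0 → LocalPauli k n) := by simp [pauliWord]
    rw [pow_zero, this]
    exact IsCombOf.of_apply _ _
  | succ K ih =>
    rw [pow_succ', pow_succ']
    exact isCombOf_pauliWord_mul hB ih

lemma isCombOf_truncated_exp
    (hB : IsCombOf (fun p : LocalPauli k n => p.1.toOp) b B) (K : ℕ) :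
    IsCombOf (pauliWord : (Fin K → LocalPauli k n) → QOp n)
      (∑ m ∈ Finset.range (K + 1), b ^ m / m.factorial)
      (∑ m ∈ Finset.range (K + 1), ((m.factorial : ℂ)⁻¹) • B ^ m) := by
  have top : ∀ K : ℕ, IsCombOf (pauliWord : (Fin K → LocalPauli k n) → QOp n)
      (b ^ K / K.factorial) (((K.factorial : ℂ)⁻¹) • B ^ K) := fun K =>
    ((isCombOf_pauliWord_pow hB K).smul _).mono (by
      rw [norm_inv, Complex.norm_natCast, div_eq_inv_mul])
  induction K with
  | zero => simpa using top 0
  | succ K ih =>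
    rw [Finset.sum_range_succ _ (K + 1), Finset.sum_range_succ _ (K + 1)]
    exact (isCombOf_pauliWord_succ ih).add (top (K + 1))

end Words

/-! ### Inverse circuits -/

section Inverse

open scoped Kronecker Matrix.Norms.L2Operator

variable {k n a : ℕ}

/-- The inverse of a gate; Pauli operators are involutions. -/
noncomputable def Gate.inv : Gate k n a → Gate k n a
  | .ancilla V => .ancilla V⁻¹
  | .pauli P hP => .pauli P hP

lemma Gate.toOp_ancilla (V : Matrix.unitaryGroup (Bits a) ℂ) :
    (Gate.ancilla V : Gate k n a).toOp = (1 : QOp n) ⊗ₖ (V : QOp a) := rfl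

lemma Gate.toOp_inv (g : Gate k n a) : g.inv.toOp = star g.toOp := by
  cases g with
  | ancilla V =>
    rw [Gate.inv, Gate.toOp_ancilla, Gate.toOp_ancilla, Matrix.star_eq_conjTranspose,
      Matrix.conjTranspose_kronecker, Matrix.conjTranspose_one]
    rfl
  | pauli P hP =>
    simp [Gate.inv, Gate.toOp, Matrix.star_eq_conjTranspose, Matrix.blockDiagonal_conjTranspose,
      PauliString.toOp_conjTranspose]

lemma Gate.star_toOp_mul_toOp (g : Gate k n a) : star g.toOp * g.toOp = 1 := by
  cases g with
  | ancilla V =>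
    rw [Gate.toOp_ancilla, Matrix.star_eq_conjTranspose, Matrix.conjTranspose_kronecker,
      Matrix.conjTranspose_one, ← Matrix.mul_kronecker_mul, ← Matrix.star_eq_conjTranspose,
      Matrix.UnitaryGroup.star_mul_self, one_mul, Matrix.one_kronecker_one]
  | pauli P hP =>
    simp only [Gate.toOp, Matrix.star_eq_conjTranspose, Matrix.blockDiagonal_conjTranspose,
      PauliString.toOp_conjTranspose, ← Matrix.blockDiagonal_mul, PauliString.toOp_mul_self]
    exact Matrix.blockDiagonal_one

lemma Gate.toOp_mem_unitary (g : Gate k n a) : g.toOp ∈ unitary _ :=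
  Unitary.mem_iff.mpr ⟨g.star_toOp_mul_toOp,
    mul_eq_one_comm.mp g.star_toOp_mul_toOp⟩

lemma Circuit.toOp_mem_unitary (Q : Circuit k n a) : Q.toOp ∈ unitary _ := by
  refine list_prod_mem fun x hx => ?_
  obtain ⟨g, -, rfl⟩ := List.mem_map.mp hx
  exact g.toOp_mem_unitary

lemma Circuit.toOp_append (Q R : Circuit k n a) :
    Circuit.toOp (Q ++ R : List (Gate k n a)) = Q.toOp * R.toOp := by
  simp [Circuit.toOp]

lemma Circuit.toOp_singleton (g : Gate k n a) :
    Circuit.toOp ([g] : List (Gate k n a)) = g.toOp := by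
  simp [Circuit.toOp]

lemma Circuit.pauliCount_append (Q R : Circuit k n a) :
    Circuit.pauliCount (Q ++ R : List (Gate k n a)) = Q.pauliCount + R.pauliCount := by
  simp [Circuit.pauliCount]

/-- The inverse of a circuit. -/
noncomputable def Circuit.inv (Q : Circuit k n a) : Circuit k n a := (List.map Gate.inv Q).reverse

lemma Circuit.toOp_inv (Q : Circuit k n a) : Q.inv.toOp = star Q.toOp := by
  rw [Circuit.toOp, Circuit.toOp, Matrix.star_eq_conjTranspose, Matrix.conjTranspose_list_prod,
    Circuit.inv, List.map_reverse, List.map_map, List.map_map]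
  simp only [Function.comp_def, Gate.toOp_inv, Matrix.star_eq_conjTranspose]

lemma Circuit.pauliCount_inv (Q : Circuit k n a) : Q.inv.pauliCount = Q.pauliCount := by
  have : ∀ g : Gate k n a, g.inv.pauliCost = g.pauliCost := fun g => by cases g <;> rfl
  simp [Circuit.pauliCount, Circuit.inv, List.map_reverse, List.sum_reverse, Function.comp_def,
    this]

lemma Circuit.toOp_flatten_replicate (Q : Circuit k n a) (r : ℕ) :
    Circuit.toOp (List.replicate r Q).flatten = Q.toOp ^ r := by
  induction r with
  | zero => simp [Circuit.toOp]
  | succ r ih => rw [List.replicate_succ, List.flatten_cons, Circuit.toOp_append, ih, pow_succ']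

lemma Circuit.pauliCount_flatten_replicate (Q : Circuit k n a) (r : ℕ) :
    Circuit.pauliCount (List.replicate r Q).flatten = r * Q.pauliCount := by
  induction r with
  | zero => simp [Circuit.pauliCount]
  | succ r ih =>
    rw [List.replicate_succ, List.flatten_cons, Circuit.pauliCount_append, ih]
    ring

end Inverse

/-! ### The zero state of the ancilla register -/

section AncillaZero

open scoped Kronecker Matrix.Norms.L2Operator

variable {k n a : ℕ}

/-- The projection `|0⟩⟨0|` on the ancilla register. -/
def ancillaZero (a : ℕ) : QOp a := Matrix.single (fun _ => 0) (fun _ => 0) 1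

lemma isStarProjection_ancillaZero (a : ℕ) : IsStarProjection (ancillaZero a) := by
  constructor
  · simp [IsIdempotentElem, ancillaZero]
  · simp [IsSelfAdjoint, ancillaZero, Matrix.star_eq_conjTranspose]

lemma isStarProjection_one_kronecker_ancillaZero (n a : ℕ) :
    IsStarProjection ((1 : QOp n) ⊗ₖ ancillaZero a) := by
  have h := isStarProjection_ancillaZero a
  constructor
  · rw [IsIdempotentElem, ← Matrix.mul_kronecker_mul, h.isIdempotentElem, one_mul]
  · rw [IsSelfAdjoint, Matrix.star_eq_conjTranspose, Matrix.conjTranspose_kronecker,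
      Matrix.conjTranspose_one, ← Matrix.star_eq_conjTranspose, h.isSelfAdjoint]

/-- The embedding `M ↦ M ⊗ |0⟩⟨0|`, a homomorphism of C⋆-algebras without units. -/
noncomputable def kroneckerAncillaZero (n a : ℕ) :
    QOp n →⋆ₙₐ[ℂ] Matrix (Bits n × Bits a) (Bits n × Bits a) ℂ where
  toFun M := M ⊗ₖ ancillaZero a
  map_smul' c M := Matrix.smul_kronecker _ _ _
  map_zero' := Matrix.zero_kronecker _
  map_add' M N := Matrix.add_kronecker _ _ _
  map_mul' M N := by
    rw [← Matrix.mul_kronecker_mul, (isStarProjection_ancillaZero a).isIdempotentElem]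
  map_star' M := by
    rw [Matrix.star_eq_conjTranspose, Matrix.star_eq_conjTranspose,
      Matrix.conjTranspose_kronecker, ← Matrix.star_eq_conjTranspose (ancillaZero a),
      (isStarProjection_ancillaZero a).isSelfAdjoint]

lemma sub_kronecker_ancillaZero (M N : QOp n) :
    (M - N) ⊗ₖ ancillaZero a = M ⊗ₖ ancillaZero a - N ⊗ₖ ancillaZero a :=
  map_sub (kroneckerAncillaZero n a) M N

lemma norm_kronecker_ancillaZero (M : QOp n) : ‖M ⊗ₖ ancillaZero a‖ = ‖M‖ := by
  refine NonUnitalStarAlgHom.norm_map (kroneckerAncillaZero n a) (fun M N h => ?_) M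
  ext x y
  have := congrFun (congrFun h (x, fun _ => 0)) (y, fun _ => 0)
  simpa [kroneckerAncillaZero, ancillaZero, Matrix.kroneckerMap_apply] using this

lemma Circuit.zero_mul_toOp_mul_zero (Q : Circuit k n a) :
    ((1 : QOp n) ⊗ₖ ancillaZero a) * Q.toOp * ((1 : QOp n) ⊗ₖ ancillaZero a)
      = Q.systemOp ⊗ₖ ancillaZero a := by
  ext ⟨x, i⟩ ⟨y, j⟩
  simp only [Matrix.mul_apply, Fintype.sum_prod_type, Matrix.kroneckerMap_apply,
    Matrix.one_apply, ancillaZero, Matrix.single_apply, Circuit.systemOp, Matrix.of_apply]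
  by_cases hi : (fun _ => 0) = i <;> by_cases hj : (fun _ => 0) = j <;>
    simp [hi, hj, ite_and]

lemma norm_matElem_le (M : QOp n) {u v : QState n} (hu : ‖u‖ = 1) (hv : ‖v‖ = 1) :
    ‖matElem M u v‖ ≤ ‖M‖ := by
  have h : matElem M u v = inner ℂ u (Matrix.toEuclideanCLM (n := Bits n) (𝕜 := ℂ) M v) := by
    rw [EuclideanSpace.inner_eq_star_dotProduct, Matrix.ofLp_toEuclideanCLM, matElem,
      dotProduct_comm]
  rw [h]
  refine (norm_inner_le_norm _ _).trans ?_
  rw [hu, one_mul]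
  refine (ContinuousLinearMap.le_opNorm _ _).trans ?_
  rw [hv, mul_one, Matrix.l2_opNorm_toEuclideanCLM]

lemma Circuit.simulates_of_norm_le {Q : Circuit k n a} {M : QOp n} {ε : ℝ}
    (h : ‖M - Q.systemOp‖ ≤ ε) : Q.Simulates M ε := by
  intro u v hu hv
  have : matElem M u v - matElem Q.systemOp u v = matElem (M - Q.systemOp) u v := by
    simp [matElem, Matrix.sub_mulVec, dotProduct_sub]
  rw [this]
  exact (norm_matElem_le _ hu hv).trans h

end AncillaZero

/-! ### Block encodings of combinations of Pauli words -/

section BlockEncoding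

open scoped Kronecker

lemma exists_unitaryGroup_column {ι : Type*} [Fintype ι] [DecidableEq ι] (i₀ : ι) (α : ι → ℂ)
    (hα : ∑ i, ‖α i‖ ^ 2 = 1) : ∃ V : Matrix.unitaryGroup ι ℂ, ∀ i, V i i₀ = α i := by
  have hv : Orthonormal ℂ
      (({i₀} : Set ι).domRestrict fun _ : ι => (WithLp.toLp 2 α : EuclideanSpace ℂ ι)) := by
    rw [orthonormal_iff_ite]
    rintro ⟨i, rfl⟩ ⟨j, rfl⟩
    have h1 : ‖(WithLp.toLp 2 α : EuclideanSpace ℂ ι)‖ = 1 := by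
      rw [EuclideanSpace.norm_eq, Real.sqrt_eq_one]
      exact hα
    simp [h1]
  obtain ⟨b, hb⟩ := hv.exists_orthonormalBasis_extension_of_card_eq (by simp)
  refine ⟨⟨(EuclideanSpace.basisFun ι ℂ).toBasis.toMatrix b,
    (EuclideanSpace.basisFun ι ℂ).toMatrix_orthonormalBasis_mem_unitary b⟩, fun i => ?_⟩
  have := hb i₀ rfl
  simp [Module.Basis.toMatrix_apply, this]

/-- Amplitudes `β` and `α` of two unit vectors with prescribed products `β⋆ α = w`: the missing
weight is put on two different indices where `w` vanishes, so that it does not contribute to the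
products. -/
lemma exists_unit_vectors_of_sum_norm_le_one {ι : Type*} [Fintype ι] [DecidableEq ι] {w : ι → ℂ}
    (hw : ∑ i, ‖w i‖ ≤ 1) {p q : ι} (hpq : p ≠ q) (hp : w p = 0) (hq : w q = 0) :
    ∃ α β : ι → ℂ, ∑ i, ‖α i‖ ^ 2 = 1 ∧ ∑ i, ‖β i‖ ^ 2 = 1 ∧ ∀ i, star (β i) * α i = w i := by
  set s := ∑ i, ‖w i‖ with hs
  -- moving the missing weight to an index where `w` vanishes yields a unit vector
  have main : ∀ (f : ι → ℂ) (l : ι), w l = 0 → (∀ i, ‖f i‖ ^ 2 = ‖w i‖) →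
      ∑ i, ‖f i + (if i = l then (√(1 - s) : ℂ) else 0)‖ ^ 2 = 1 := by
    intro f l hl hf
    have h0 : f l = 0 := by simpa [hl] using hf l
    have : ∀ i, ‖f i + (if i = l then (√(1 - s) : ℂ) else 0)‖ ^ 2
        = ‖w i‖ + if i = l then 1 - s else 0 := by
      intro i
      split_ifs with hi
      · subst hi
        rw [h0, zero_add, hl, norm_zero, zero_add, Complex.norm_real, Real.norm_eq_abs, sq_abs,
          Real.sq_sqrt (by linarith)]
      · rw [add_zero, add_zero, hf]
    simp only [this, Finset.sum_add_distrib, Finset.sum_ite_eq', Finset.mem_univ, if_true]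
    linarith
  refine ⟨fun i => w i / √‖w i‖ + (if i = p then (√(1 - s) : ℂ) else 0),
    fun i => √‖w i‖ + (if i = q then (√(1 - s) : ℂ) else 0),
    main _ p hp fun i => ?_, main _ q hq fun i => ?_, fun i => ?_⟩
  · rw [norm_div, Complex.norm_real, Real.norm_of_nonneg (Real.sqrt_nonneg _), div_pow,
      Real.sq_sqrt (norm_nonneg _), sq, mul_self_div_self]
  · rw [Complex.norm_real, Real.norm_of_nonneg (Real.sqrt_nonneg _), Real.sq_sqrt (norm_nonneg _)]
  · by_cases hi : i = p
    · subst hi; simp [hp, hpq]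
    by_cases hi' : i = q
    · subst hi'; simp [hq, hi]
    by_cases h0 : w i = 0
    · simp [hi, hi', h0]
    have h1 : (√‖w i‖ : ℂ) ≠ 0 := by
      rw [Complex.ofReal_ne_zero, Real.sqrt_ne_zero']
      exact norm_pos_iff.mpr h0
    simp only [hi, hi', if_false, add_zero, Complex.star_def, Complex.conj_ofReal]
    field_simp

variable {k n a K : ℕ}

/-- Application of the Pauli word that the ancilla register selects through `d`. -/
def selectWord (d : Bits a → Fin K → LocalPauli k n) : Circuit k n a :=
  List.ofFn fun i => Gate.pauli (fun b => (d b i).1) fun b => (d b i).2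

lemma selectWord_toOp (d : Bits a → Fin K → LocalPauli k n) :
    (selectWord d).toOp = Matrix.blockDiagonal fun b => pauliWord (d b) := by
  have h := map_list_prod (Matrix.blockDiagonalRingHom (Bits n) (Bits a) ℂ)
    (List.ofFn fun i => fun b => (d b i).1.toOp)
  rw [Circuit.toOp, selectWord, List.map_ofFn]
  rw [List.map_ofFn] at h
  refine h.symm.trans (congrArg Matrix.blockDiagonal ?_)
  ext1 b
  refine (map_list_prod (Pi.evalMonoidHom (fun _ : Bits a => QOp n) b) _).trans ?_
  rw [List.map_ofFn, pauliWord]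
  rfl

lemma selectWord_pauliCount (d : Bits a → Fin K → LocalPauli k n) :
    (selectWord d).pauliCount = K := by
  simp [Circuit.pauliCount, selectWord, List.map_ofFn, Function.comp_def, Gate.pauliCost]

lemma systemOp_select (V V' : Matrix.unitaryGroup (Bits a) ℂ)
    (d : Bits a → Fin K → LocalPauli k n) :
    Circuit.systemOp ([Gate.ancilla V'⁻¹] ++ selectWord d ++ [Gate.ancilla V] : List (Gate k n a))
      = ∑ b, (star (V' b fun _ => 0) * V b fun _ => 0) • pauliWord (d b) := by
  ext x y
  rw [Circuit.systemOp, Circuit.toOp_append, Circuit.toOp_append, Circuit.toOp_singleton,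
    Circuit.toOp_singleton, selectWord_toOp, Gate.toOp_ancilla, Gate.toOp_ancilla,
    Matrix.UnitaryGroup.inv_val]
  simp only [Matrix.of_apply, Matrix.mul_apply, Fintype.sum_prod_type, Matrix.kroneckerMap_apply,
    Matrix.one_apply, Matrix.blockDiagonal_apply, Matrix.star_apply, Matrix.sum_apply,
    Matrix.smul_apply, smul_eq_mul]
  simp [mul_ite, ite_mul, Finset.sum_ite_eq]
  exact Finset.sum_congr rfl fun b _ => by ring

/-- Linear combination of unitaries: a combination of Pauli words of length `K` with total weight
at most `1` is the block of a circuit with `K` Pauli operators. -/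
lemma exists_circuit_of_isCombOf {M : QOp n}
    (hM : IsCombOf (pauliWord : (Fin K → LocalPauli k n) → QOp n) 1 M)
    (ha : Fintype.card (LocalPauli k n) ^ K + 2 ≤ 2 ^ a) :
    ∃ Q : Circuit k n a, Q.systemOp = M ∧ Q.pauliCount = K := by
  classical
  obtain ⟨w, hw, rfl⟩ := hM
  obtain ⟨e⟩ : Nonempty ((Fin K → LocalPauli k n) ⊕ Bool ↪ Bits a) :=
    Function.Embedding.nonempty_of_card_le (by simpa using ha)
  have hinj : Function.Injective fun j : Fin K → LocalPauli k n => e (Sum.inl j) :=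
    e.injective.comp Sum.inl_injective
  set w' : Bits a → ℂ := Function.extend (fun j => e (Sum.inl j)) w 0 with hw'
  set d : Bits a → Fin K → LocalPauli k n :=
    Function.extend (fun j => e (Sum.inl j)) id default with hd
  have hw'e : ∀ j, w' (e (Sum.inl j)) = w j := fun j => hinj.extend_apply _ _ _
  have hde : ∀ j, d (e (Sum.inl j)) = j := fun j => hinj.extend_apply _ _ _
  have hw'0 : ∀ b, b ∉ Set.range (fun j : Fin K → LocalPauli k n => e (Sum.inl j)) → w' b = 0 :=
    fun b hb => Function.extend_apply' _ _ _ hb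
  have hbool : ∀ c : Bool, w' (e (Sum.inr c)) = 0 := fun c => hw'0 _ (by
    rintro ⟨j, hj⟩
    exact Sum.inl_ne_inr (e.injective hj))
  have hsum : ∑ b, ‖w' b‖ ≤ 1 := by
    rw [← Fintype.sum_of_injective _ hinj (fun j => ‖w j‖) (fun b => ‖w' b‖)
      (fun b hb => by rw [hw'0 b hb, norm_zero]) fun j => by rw [hw'e]]
    exact hw
  obtain ⟨α, β, hα, hβ, hαβ⟩ := exists_unit_vectors_of_sum_norm_le_one hsum
    (p := e (Sum.inr true)) (q := e (Sum.inr false)) (fun h => by simpa using e.injective h)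
    (hbool _) (hbool _)
  obtain ⟨V, hV⟩ := exists_unitaryGroup_column (fun _ => 0) α hα
  obtain ⟨V', hV'⟩ := exists_unitaryGroup_column (fun _ => 0) β hβ
  refine ⟨([Gate.ancilla V'⁻¹] ++ selectWord d ++ [Gate.ancilla V] : List (Gate k n a)), ?_, ?_⟩
  · rw [systemOp_select]
    simp only [hV, hV', hαβ]
    exact (Fintype.sum_of_injective _ hinj (fun j => w j • pauliWord j)
      (fun b => w' b • pauliWord (d b)) (fun b hb => by rw [hw'0 b hb, zero_smul])
      fun j => by rw [hw'e, hde]).symm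
  · rw [Circuit.pauliCount_append, Circuit.pauliCount_append, selectWord_pauliCount]
    simp [Circuit.pauliCount, Gate.pauliCost]

end BlockEncoding

/-! ### Amplified circuits -/

section AmplifiedCircuit

open scoped Kronecker Matrix.Norms.L2Operator

variable {k n a : ℕ}

/-- The reflection `2 |0⟩⟨0| - 1` of the ancilla register. -/
noncomputable def ancillaReflection (a : ℕ) : Matrix.unitaryGroup (Bits a) ℂ :=
  ⟨2 * ancillaZero a - 1, (isStarProjection_ancillaZero a).two_mul_sub_one_mem_unitary⟩

/-- One round of oblivious amplitude amplification of the block of `Q`. -/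
noncomputable def Circuit.amplify (Q : Circuit k n a) : Circuit k n a :=
  Q ++ [Gate.ancilla (ancillaReflection a)] ++ Q.inv ++ [Gate.ancilla (-ancillaReflection a)] ++ Q

lemma one_kronecker_ancillaReflection :
    (1 : QOp n) ⊗ₖ (ancillaReflection a : QOp a) = 2 * ((1 : QOp n) ⊗ₖ ancillaZero a) - 1 := by
  have h : (ancillaReflection a : QOp a) = 2 * ancillaZero a - 1 := rfl
  rw [h, two_mul, two_mul, ← Matrix.one_kronecker_one, ← Matrix.kronecker_add]
  ext ⟨x, i⟩ ⟨y, j⟩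
  simp only [Matrix.kroneckerMap_apply, Matrix.sub_apply, mul_sub]

lemma Circuit.toOp_amplify (Q : Circuit k n a) :
    Q.amplify.toOp = Q.toOp * (2 * ((1 : QOp n) ⊗ₖ ancillaZero a) - 1) * star Q.toOp *
      (1 - 2 * ((1 : QOp n) ⊗ₖ ancillaZero a)) * Q.toOp := by
  have h : (1 : QOp n) ⊗ₖ ((-ancillaReflection a : Matrix.unitaryGroup (Bits a) ℂ) : QOp a)
      = 1 - 2 * ((1 : QOp n) ⊗ₖ ancillaZero a) := by
    rw [← neg_sub, ← one_kronecker_ancillaReflection]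
    have h1 : ((-ancillaReflection a : Matrix.unitaryGroup (Bits a) ℂ) : QOp a)
        = -(ancillaReflection a : QOp a) := rfl
    ext ⟨x, i⟩ ⟨y, j⟩
    simp [Matrix.kroneckerMap_apply, h1]
  rw [Circuit.amplify, Circuit.toOp_append, Circuit.toOp_append, Circuit.toOp_append,
    Circuit.toOp_append, Circuit.toOp_singleton, Circuit.toOp_singleton, Gate.toOp_ancilla,
    Gate.toOp_ancilla, Circuit.toOp_inv, one_kronecker_ancillaReflection, h]

lemma Circuit.pauliCount_amplify (Q : Circuit k n a) : Q.amplify.pauliCount = 3 * Q.pauliCount := by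
  rw [Circuit.amplify, Circuit.pauliCount_append, Circuit.pauliCount_append,
    Circuit.pauliCount_append, Circuit.pauliCount_append, Circuit.pauliCount_inv]
  simp [Circuit.pauliCount, Gate.pauliCost]
  ring

/-- Repeated amplification of a block that is close to half of a unitary. -/
lemma Circuit.norm_pow_sub_systemOp_le (Q : Circuit k n a) {U : QOp n} {δ : ℝ}
    (hU : U ∈ unitary (QOp n)) (hδ : δ ≤ 1) (h : ‖(2 : ℂ) • Q.systemOp - U‖ ≤ δ) (r : ℕ) :
    ‖U ^ r - Circuit.systemOp (List.replicate r Q.amplify).flatten‖ ≤ r * √(10 * δ) := by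
  set p := (1 : QOp n) ⊗ₖ ancillaZero a with hpdef
  set u := U ⊗ₖ (1 : QOp a) with hudef
  have hp : IsStarProjection p := isStarProjection_one_kronecker_ancillaZero n a
  have hu : u ∈ unitary (Matrix (Bits n × Bits a) (Bits n × Bits a) ℂ) :=
    Matrix.kronecker_mem_unitary hU (one_mem _)
  have hupow : ∀ r, u ^ r * p = (U ^ r) ⊗ₖ ancillaZero a := by
    intro r
    have : u ^ r = (U ^ r) ⊗ₖ (1 : QOp a) := by
      induction r with
      | zero => simp
      | succ r ih => rw [pow_succ, ih, hudef, ← Matrix.mul_kronecker_mul, one_mul, pow_succ]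
    rw [this, hpdef, ← Matrix.mul_kronecker_mul, one_mul, mul_one]
  have hup : Commute u p := by
    rw [Commute, SemiconjBy, hudef, hpdef, ← Matrix.mul_kronecker_mul, ← Matrix.mul_kronecker_mul]
    simp
  have hpow : ‖(2 : ℂ) • (p * Q.toOp * p) - u * p‖ ≤ δ := by
    rw [Q.zero_mul_toOp_mul_zero, ← pow_one u, hupow, pow_one, ← Matrix.smul_kronecker,
      ← sub_kronecker_ancillaZero, norm_kronecker_ancillaZero]
    exact h
  have h1 := norm_amplified_block_sub_le hp Q.toOp_mem_unitary hu hδ hpow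
  rw [← Circuit.toOp_amplify] at h1
  have h2 := norm_mul_projection_sub_le hp Q.amplify.toOp_mem_unitary hu hup h1
  have h3 := norm_pow_mul_projection_sub_le Q.amplify.toOp_mem_unitary hu hup h2 r
  have hpn : ‖p‖ ≤ 1 := norm_le_one_of_star_mul_self_mul (by
    rw [hp.isSelfAdjoint.star_eq, hp.isIdempotentElem.eq, hp.isIdempotentElem.eq])
  rw [norm_sub_rev, ← norm_kronecker_ancillaZero (a := a), sub_kronecker_ancillaZero,
    ← Circuit.zero_mul_toOp_mul_zero, ← hupow, Circuit.toOp_flatten_replicate]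
  have e : p * Q.amplify.toOp ^ r * p - u ^ r * p = p * (Q.amplify.toOp ^ r * p - u ^ r * p) := by
    have : p * (u ^ r * p) = u ^ r * p := by
      rw [← mul_assoc, ← (hup.pow_left r).eq, mul_assoc, hp.isIdempotentElem.eq]
    rw [mul_sub, this, mul_assoc]
  rw [e]
  calc _ ≤ ‖p‖ * ‖Q.amplify.toOp ^ r * p - u ^ r * p‖ := norm_mul_le _ _
    _ ≤ 1 * (r * √(2 * (5 * δ))) := by gcongr
    _ = r * √(10 * δ) := by ring_nf

end AmplifiedCircuit

/-! ### Hamiltonian simulation -/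

section Simulation

open scoped Matrix.Norms.L2Operator

variable {k n : ℕ}

lemma evolution_mem_unitary {H : QOp n} (hH : H.IsHermitian) (t : ℝ) :
    evolution H t ∈ unitary (QOp n) := by
  let _ : NormedAlgebra ℚ (QOp n) := .restrictScalars ℚ ℂ _
  refine NormedSpace.exp_mem_unitary_of_mem_skewAdjoint ?_
  rw [skewAdjoint.mem_iff, star_smul, Matrix.star_eq_conjTranspose, hH.eq, ← neg_smul]
  simp

lemma evolution_div_pow (H : QOp n) (t : ℝ) {r : ℕ} (hr : r ≠ 0) :
    evolution H (t / r) ^ r = evolution H t := by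
  have : (r : ℂ) ≠ 0 := Nat.cast_ne_zero.mpr hr
  rw [evolution, ← Matrix.exp_nsmul, ← Nat.cast_smul_eq_nsmul ℂ, smul_smul, evolution]
  congr 2
  push_cast
  field_simp

/-- Simulation of a combination of local Pauli strings of weight `l`, in `r` segments of equal
length, each of which applies amplitude amplification to the Taylor polynomial of degree `K`. -/
lemma exists_circuit_simulates {H : QOp n} (hH : H.IsHermitian) {l t ε : ℝ}
    (hl : IsCombOf (fun p : LocalPauli k n => p.1.toOp) l H) (ht : 0 < t) (hε : 0 < ε)
    {a r K : ℕ} (hr : r ≠ 0) (hrt : 2 * (t * l) ≤ r)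
    (hK : 10 * (r / ε) ^ 2 ≤ K.factorial)
    (ha : Fintype.card (LocalPauli k n) ^ K + 2 ≤ 2 ^ a) :
    ∃ Q : Circuit k n a, Q.Simulates (evolution H t) ε ∧ Q.pauliCount = r * (3 * K) := by
  have hr0 : (0 : ℝ) < r := by positivity
  set B : QOp n := (-(Complex.I * ((t / r : ℝ) : ℂ))) • H with hB
  have hcomb : IsCombOf (fun p : LocalPauli k n => p.1.toOp) (1 / 2) B := by
    refine (hl.smul _).mono ?_
    rw [norm_neg, norm_mul, Complex.norm_I, one_mul, Complex.norm_real,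
      Real.norm_of_nonneg (by positivity), div_mul_eq_mul_div, div_le_iff₀ hr0]
    linarith
  have hBn : ‖B‖ ≤ 1 / 2 := hcomb.norm_le fun p => p.1.norm_toOp_le
  set T : QOp n := ∑ m ∈ Finset.range (K + 1), ((m.factorial : ℂ)⁻¹) • B ^ m with hT
  have htrunc : ‖evolution H (t / r) - T‖ ≤ 1 / K.factorial := norm_exp_sub_sum_range_le hBn K
  have hT1 : IsCombOf (pauliWord : (Fin K → LocalPauli k n) → QOp n) 1 ((1 / 2 : ℂ) • T) := by
    refine ((isCombOf_truncated_exp hcomb K).smul _).mono ?_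
    have h1 := Real.sum_le_exp_of_nonneg (by norm_num : (0 : ℝ) ≤ 1 / 2) (K + 1)
    -- the total weight of the Taylor series is `√e ≤ 2`
    have h2 : Real.exp (1 / 2) ≤ 2 := by
      have h3 : Real.exp (1 / 2) ^ 2 = Real.exp 1 := by
        rw [← Real.exp_nat_mul]; norm_num
      nlinarith [Real.exp_one_lt_d9, Real.exp_pos (1 / 2)]
    norm_num at h1 h2 ⊢
    linarith
  obtain ⟨Q, hQ, hcount⟩ := exists_circuit_of_isCombOf hT1 ha
  refine ⟨(List.replicate r Q.amplify).flatten, Circuit.simulates_of_norm_le ?_, ?_⟩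
  · rw [← evolution_div_pow H t hr]
    have hK1 : (1 : ℝ) ≤ K.factorial := by exact_mod_cast K.factorial_pos
    refine (Q.norm_pow_sub_systemOp_le (evolution_mem_unitary hH _) (δ := 1 / K.factorial)
      ?_ ?_ r).trans ?_
    · rw [div_le_one (by positivity)]; exact hK1
    · rw [hQ, smul_smul, norm_sub_rev]
      norm_num
      simpa using htrunc
    · rw [← le_div_iff₀' hr0, Real.sqrt_le_left (by positivity), mul_one_div,
        div_le_iff₀ (by positivity)]
      calc (10 : ℝ) = (ε / r) ^ 2 * (10 * (r / ε) ^ 2) := by field_simp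
        _ ≤ _ := by gcongr
  · rw [Circuit.pauliCount_flatten_replicate, Circuit.pauliCount_amplify, hcount]

lemma card_localPauli_pow_add_two_le (hn : 1 ≤ n) (K : ℕ) :
    Fintype.card (LocalPauli k n) ^ K + 2 ≤ 2 ^ (K * (k * (3 + Nat.log 2 n)) + 2) := by
  have h1 : n ≤ 2 ^ (Nat.log 2 n + 1) := (Nat.lt_pow_succ_log_self (by norm_num) n).le
  have h2 : Fintype.card (LocalPauli k n) ≤ 2 ^ (k * (3 + Nat.log 2 n)) := by
    calc _ ≤ (4 * n) ^ k := card_localPauli_le hn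
      _ ≤ (4 * 2 ^ (Nat.log 2 n + 1)) ^ k := by gcongr
      _ = _ := by
        rw [mul_comm k, pow_mul]
        congr 1
        ring
  have h3 : Fintype.card (LocalPauli k n) ^ K ≤ 2 ^ (K * (k * (3 + Nat.log 2 n))) := by
    calc _ ≤ (2 ^ (k * (3 + Nat.log 2 n))) ^ K := by gcongr
      _ = _ := by rw [← pow_mul, mul_comm]
  have h4 : 1 ≤ 2 ^ (K * (k * (3 + Nat.log 2 n))) := Nat.one_le_two_pow
  rw [pow_add]
  omega

lemma log_two_le_log_add_one (hn : 1 ≤ n) : Real.log 2 ≤ Real.log (n + 1) :=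
  Real.log_le_log (by norm_num) (by
    have : (1 : ℝ) ≤ n := by exact_mod_cast hn
    linarith)

lemma three_add_log_le (hn : 1 ≤ n) :
    ((3 + Nat.log 2 n : ℕ) : ℝ) ≤ 6 * Real.log (n + 1) := by
  have hn' : (1 : ℝ) ≤ n := by exact_mod_cast hn
  have h1 : (Nat.log 2 n : ℝ) ≤ Real.log n / Real.log 2 := by
    simpa [Real.logb] using Real.natLog_le_logb n 2
  have h2 := log_two_le_log_add_one hn
  have h3 : Real.log n ≤ Real.log (n + 1) := Real.log_le_log (by linarith) (by linarith)
  have h4 := Real.log_two_gt_d9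
  rw [le_div_iff₀ (by linarith)] at h1
  push_cast
  nlinarith [(Nat.cast_nonneg (Nat.log 2 n) : (0 : ℝ) ≤ Nat.log 2 n)]

end Simulation

theorem corollary2 :
    ∃ A : ℝ, 0 < A ∧
      ∀ (n k : ℕ) (c : Equiv.Perm (Fin n) → ℂ) (t ε L : ℝ),
        1 ≤ k →
        IsLocalElement k c →
        (groupAlgOp c).IsHermitian →
        0 < t →
        0 < ε →
        L = 2 ^ (k - 1) * maxCoeff c →
        1 ≤ t * L * (n : ℝ) ^ k →
        Real.exp 1 < t * L * (n : ℝ) ^ k / ε →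
        ∃ (a : ℕ) (Q : Circuit k n a),
          Q.Simulates (evolution (groupAlgOp c) t) ε ∧
          (Q.pauliCount : ℝ) ≤
            A * (t * L * (n : ℝ) ^ k * logRatio (t * L * (n : ℝ) ^ k / ε)) ∧
          (a : ℝ) ≤
            A * (k * Real.log (n + 1) * logRatio (t * L * (n : ℝ) ^ k / ε)) := by
  refine ⟨100, by norm_num, ?_⟩
  intro n k c t ε L hk hc hH ht hε hL hx hy
  have hn : 1 ≤ n := by
    rcases Nat.eq_zero_or_pos n with rfl | hn
    · rw [Nat.cast_zero, zero_pow (by omega), mul_zero] at hx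
      linarith
    · exact hn
  have hcomb := isCombOf_groupAlgOp hn hc
  rw [← hL] at hcomb
  obtain ⟨K, hKfac, hK⟩ := exists_factorial_ge hy
  have hR := one_le_logRatio hy
  set R := logRatio (t * L * (n : ℝ) ^ k / ε)
  set x := t * L * (n : ℝ) ^ k with hxdef
  have hr2 : 2 * x ≤ ⌈2 * x⌉₊ := Nat.le_ceil _
  have hr3 : (⌈2 * x⌉₊ : ℝ) ≤ 3 * x := by
    have := Nat.ceil_lt_add_one (by linarith : 0 ≤ 2 * x)
    linarith
  have hr0 : ⌈2 * x⌉₊ ≠ 0 := by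
    rw [← Nat.pos_iff_ne_zero, Nat.ceil_pos]; linarith
  have hfac : 10 * ((⌈2 * x⌉₊ : ℝ) / ε) ^ 2 ≤ K.factorial := by
    calc 10 * ((⌈2 * x⌉₊ : ℝ) / ε) ^ 2 ≤ 10 * (3 * x / ε) ^ 2 := by gcongr
      _ = 90 * (x / ε) ^ 2 := by ring
      _ ≤ _ := hKfac
  obtain ⟨Q, hQ, hcount⟩ := exists_circuit_simulates hH hcomb ht hε hr0
    (by rw [← mul_assoc t]; exact hr2) hfac (card_localPauli_pow_add_two_le hn K)
  refine ⟨_, Q, hQ, ?_, ?_⟩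
  · rw [hcount]
    push_cast
    calc (⌈2 * x⌉₊ : ℝ) * (3 * K) ≤ 3 * x * (3 * (11 * R)) := by gcongr
      _ ≤ 100 * (x * R) := by nlinarith [mul_pos (by linarith : 0 < x) (by linarith : 0 < R)]
  · have hlog := three_add_log_le hn
    have hlog2 := (Real.log_two_gt_d9.trans_le (log_two_le_log_add_one hn)).le
    set l := Real.log (n + 1)
    have hk' : (1 : ℝ) ≤ k := by exact_mod_cast hk
    have h2 : 0.6931471803 ≤ k * l * R := by
      calc (0.6931471803 : ℝ) = 1 * 0.6931471803 * 1 := by norm_num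
        _ ≤ k * l * R := by gcongr
    rw [Nat.cast_add, Nat.cast_mul, Nat.cast_mul k]
    calc (K : ℝ) * (k * ((3 + Nat.log 2 n : ℕ) : ℝ)) + (2 : ℕ)
        ≤ 11 * R * (k * (6 * l)) + 2 := by push_cast at hlog ⊢; gcongr
      _ ≤ 100 * (k * l * R) := by norm_num at h2 ⊢; linarith
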